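/- Let $\mathbf k$ be a field of characteristic $0$ with pairwise commuting derivations $\delta_1,\dots,\delta_m$, let $Y=\{y_1,\dots,y_n\}$ be differential indeterminates, $\Theta$ the monoid of derivative operators $\delta_1^{k_1}\cdots\delta_m^{k_m}$, and $\mathbf k\{Y\}=\mathbf k[\Theta Y]$ the ring of differential polynomials. Fix a ranking on $\Theta Y$, i.e. a total order with $\theta u\ge u$ and $u\ge v\Rightarrow\theta u\ge\theta v$ for all $\theta\in\Theta$, $u,v\in\Theta Y$. The leader $u_f$ of $f\in\mathbf k\{Y\}\setminus\mathbf k$ is the highest derivative occurring in $f$; the rank of $f$ is $u_f^{\deg_{u_f}f}$; the initial of $f$ is its leading coefficient as a polynomial in $u_f$, and its separant is $\partial f/\partial u_f$. For $A\subset\mathbf k\{Y\}\setminus\mathbf k$, $H_A$ is the set of the initials and separants of the elements of $A$ and $\operatorname{ld}A$ is the set of their leaders. The set $A$ is autoreduced if for all distinct $f,g\in A$ no proper derivative of $u_g$ occurs in $f$ and $\deg_{u_g}f<\deg_{u_g}g$. Autoreduced sets (which are finite) are compared by listing the ranks of their elements increasingly: at the first difference the set with the smaller entry is lower, and a proper extension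 of a list is lower than the list. A characteristic set of a set $X\subset\mathbf k\{Y\}$ is an autoreduced subset of $X$ of lowest rank. $[F]$ denotes the differential ideal generated by $F$, and $J:S^\infty=\{a\mid sa\in J\text{ for some }s\in S^\infty\}$, where $S^\infty$ is the multiplicative set (containing $1$) generated by $S$. Let $C$ be a characteristic set of the differential ideal $I=[C]:H_C^\infty$, and let $\bar L$ be a differential prolongation of $L=\operatorname{ld}C$, i.e. $L\subseteq\bar L\subseteq\Theta L$ and $\Theta L\setminus\bar L$ is closed under every $\delta_i$. Put $N=\Theta Y\setminus\Theta L$ and, for an ideal $J$ of $\mathbf k\{Y\}$, let $\bar J_{\bar L}=J\cap\mathbf k[\bar L\cup N]$, an ideal of the polynomial ring $\mathbf k[\bar L\cup N]$. Let $I=P_1\cap\dots\cap P_s$ be the essential prime decomposition of $I$, i.e. the $P_i$ are prime differential ideals and $P_i\not\subseteq P_j$ for $i\ne j$. Then $$\bar I_{\bar L}=(\bar P_1)_{\bar L}\cap\dots\cap(\bar P_s)_{\bar L}$$ is the minimal prime decomposition of $\bar I_{\bar L}$: the ideals $(\bar P_i)_{\bar L}$ are prime, none of them contains another one, and they are exactly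 the minimal primes of $\bar I_{\bar L}$. -/

import Mathlib

namespace DiffAlg

/-- The derivatives `θ y_j` of `n` differential indeterminates with respect to `m` commuting
derivations: `(j, (k_1, …, k_m))` stands for `δ_1^{k_1} ⋯ δ_m^{k_m} y_j`. -/
abbrev DVar (n m : ℕ) := Fin n × (Fin m → ℕ)

/-- The action of the derivative operator `θ = δ_1^{k_1} ⋯ δ_m^{k_m}` on derivatives. -/
def act {n m : ℕ} (θ : Fin m → ℕ) (u : DVar n m) : DVar n m := (u.1, θ + u.2)

/-- The underlying ring of the ring `k{y_1, …, y_n}` of differential polynomials. -/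
abbrev DPoly (n m : ℕ) (k : Type*) [CommRing k] := MvPolynomial (DVar n m) k

section Derivations

variable {σ : Type*} {k : Type*} [CommRing k]

/-- Apply a derivation of the coefficient ring to every coefficient of a polynomial. -/
noncomputable def coeffDerivAux (d : Derivation ℤ k k) :
    MvPolynomial σ k →+ MvPolynomial σ k where
  toFun f := (AddMonoidAlgebra.coeff f).sum fun s a => MvPolynomial.monomial s (d a)
  map_zero' := by simp
  map_add' f g := by
    rw [AddMonoidAlgebra.coeff_add]
    exact Finsupp.sum_add_index' (by simp) (by simp)

theorem coeffDerivAux_monomial (d : Derivation ℤ k k) (s : σ →₀ ℕ) (a : k) :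
    coeffDerivAux d (MvPolynomial.monomial s a) = MvPolynomial.monomial s (d a) :=
  MvPolynomial.sum_monomial_eq (b := fun s a => MvPolynomial.monomial s (d a)) (by simp)

theorem coeffDerivAux_mul (d : Derivation ℤ k k) (f g : MvPolynomial σ k) :
    coeffDerivAux d (f * g) = f * coeffDerivAux d g + g * coeffDerivAux d f := by
  induction f using MvPolynomial.induction_on' with
  | add p q hp hq => rw [add_mul, map_add, map_add, hp, hq]; ring
  | monomial s a =>
    induction g using MvPolynomial.induction_on' with
    | add p q hp hq => rw [mul_add, map_add, map_add, hp, hq]; ring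
    | monomial t b =>
      simp only [MvPolynomial.monomial_mul, coeffDerivAux_monomial, Derivation.leibniz,
        smul_eq_mul, map_add]
      rw [add_comm t s]

/-- The derivation of a polynomial ring that acts by `d` on coefficients and kills all
variables. -/
noncomputable def coeffDeriv (d : Derivation ℤ k k) :
    Derivation ℤ (MvPolynomial σ k) (MvPolynomial σ k) :=
  Derivation.mk' (coeffDerivAux d).toIntLinearMap (coeffDerivAux_mul d)

/-- The derivation `δ_i` of `k{y_1, …, y_n}`: it extends the derivation `δ_i` of `k` and maps the
derivative `u` to `δ_i u`. -/
noncomputable def polyDeriv {n m : ℕ} (d : Fin m → Derivation ℤ k k) (i : Fin m) :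
    Derivation ℤ (DPoly n m k) (DPoly n m k) :=
  coeffDeriv (d i) +
    (MvPolynomial.mkDerivation k
      (fun u : DVar n m => (MvPolynomial.X (act (Pi.single i 1) u) : DPoly n m k))).restrictScalars ℤ

end Derivations

/-- A ranking on the set of derivatives. -/
structure Ranking (n m : ℕ) where
  le : DVar n m → DVar n m → Prop
  le_trans : ∀ u v w, le u v → le v w → le u w
  le_antisymm : ∀ u v, le u v → le v u → u = v
  le_total : ∀ u v, le u v ∨ le v u
  le_act : ∀ θ u, le u (act θ u)
  act_le_act : ∀ θ u v, le v u → le (act θ v) (act θ u)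

section Polynomials

variable {n m : ℕ} {k : Type*} [Field k]

/-- `u` is the leader of `f`: the derivative of the highest rank that appears in `f`. (A polynomial
has a leader, and then exactly one, iff it is not in `k`.) -/
def IsLeader (r : Ranking n m) (f : DPoly n m k) (u : DVar n m) : Prop :=
  u ∈ f.vars ∧ ∀ v ∈ f.vars, r.le v u

/-- The set of leaders of the elements of `A`. -/
def leaders (r : Ranking n m) (A : Set (DPoly n m k)) : Set (DVar n m) :=
  {u | ∃ f ∈ A, IsLeader r f u}

/-- The coefficient of `u ^ d` in `f`, when `f` is viewed as a univariate polynomial in `u`. -/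
noncomputable def coeffIn (u : DVar n m) (d : ℕ) (f : DPoly n m k) : DPoly n m k :=
  ∑ s ∈ f.support with s u = d, MvPolynomial.monomial (s.erase u) (MvPolynomial.coeff s f)

/-- The leading coefficient of `f`, when `f` is viewed as a univariate polynomial in `u`; it is the
initial of `f` if `u` is the leader of `f`. -/
noncomputable def initialAt (u : DVar n m) (f : DPoly n m k) : DPoly n m k :=
  coeffIn u (f.degreeOf u) f

/-- The set `H_A` of the initials and the separants `∂f/∂u_f` of the elements `f` of `A`. -/
def initSep (r : Ranking n m) (A : Set (DPoly n m k)) : Set (DPoly n m k) :=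
  {h | ∃ f ∈ A, ∃ u, IsLeader r f u ∧ (h = initialAt u f ∨ h = MvPolynomial.pderiv u f)}

/-- `f` is reduced with respect to `g` (for `g` not in `k`): no proper derivative of the leader `u`
of `g` appears in `f`, and `deg_u f < deg_u g`. -/
def IsReduced (r : Ranking n m) (f g : DPoly n m k) : Prop :=
  ∀ u, IsLeader r g u →
    (∀ θ : Fin m → ℕ, θ ≠ 0 → act θ u ∉ f.vars) ∧ f.degreeOf u < g.degreeOf u

/-- Autoreduced sets (these are always finite). -/
def IsAutoreduced (r : Ranking n m) (A : Finset (DPoly n m k)) : Prop :=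
  (∀ f ∈ A, f ∉ Set.range (MvPolynomial.C : k → DPoly n m k)) ∧
    ∀ f ∈ A, ∀ g ∈ A, f ≠ g → IsReduced r f g

/-- The pair `(u, d)` encodes the rank `u ^ d` of `f`. -/
def IsRank (r : Ranking n m) (f : DPoly n m k) (p : DVar n m × ℕ) : Prop :=
  IsLeader r f p.1 ∧ p.2 = f.degreeOf p.1

/-- The strict order on ranks `u ^ d`. -/
def rankLT (r : Ranking n m) (p q : DVar n m × ℕ) : Prop :=
  (r.le p.1 q.1 ∧ p.1 ≠ q.1) ∨ (p.1 = q.1 ∧ p.2 < q.2)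

/-- `l` is the list of the ranks of the elements of `A`, when these are arranged in the order of
increasing rank. -/
def IsRankSeq (r : Ranking n m) (A : Finset (DPoly n m k)) (l : List (DVar n m × ℕ)) : Prop :=
  l.Pairwise (rankLT r) ∧
    ∃ a : List (DPoly n m k), a.Nodup ∧ (∀ f, f ∈ a ↔ f ∈ A) ∧ List.Forall₂ (IsRank r) a l

/-- Comparison of increasing lists of ranks: at the first difference `l` has the smaller entry, or
`l` is a proper extension of `l'`. -/
def RankSeqLT (r : Ranking n m) (l l' : List (DVar n m × ℕ)) : Prop :=
  (∃ i, ∃ (h : i < l.length) (h' : i < l'.length),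
      (∀ j < i, l[j]? = l'[j]?) ∧ rankLT r l[i] l'[i]) ∨
    (l'.length < l.length ∧ ∀ j < l'.length, l[j]? = l'[j]?)

/-- `A` has lower rank than `B`. -/
def LowerRank (r : Ranking n m) (A B : Finset (DPoly n m k)) : Prop :=
  ∃ l l', IsRankSeq r A l ∧ IsRankSeq r B l' ∧ RankSeqLT r l l'

/-- `A` is a characteristic set (in Kolchin's sense) of `X`: an autoreduced subset of `X` of the
lowest rank. -/
def IsCharacteristicSet (r : Ranking n m) (X : Set (DPoly n m k)) (A : Finset (DPoly n m k)) :
    Prop :=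
  IsAutoreduced r A ∧ (A : Set (DPoly n m k)) ⊆ X ∧
    ∀ B : Finset (DPoly n m k), IsAutoreduced r B → (B : Set (DPoly n m k)) ⊆ X →
      ¬ LowerRank r B A

/-- Differential ideals of `k{y_1, …, y_n}`. -/
def IsDifferential (d : Fin m → Derivation ℤ k k) (I : Ideal (DPoly n m k)) : Prop :=
  ∀ i, ∀ f ∈ I, polyDeriv d i f ∈ I

/-- The differential ideal `[F]` generated by `F`. -/
noncomputable def diffSpan (d : Fin m → Derivation ℤ k k) (F : Set (DPoly n m k)) : Ideal (DPoly n m k) :=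
  sInf {J | IsDifferential d J ∧ F ⊆ J}

end Polynomials

/-- The saturated ideal `I : S^∞`, where `S^∞` is the multiplicative set generated by `S`. -/
def saturation {R : Type*} [CommRing R] (I : Ideal R) (S : Set R) : Ideal R where
  carrier := {a | ∃ s ∈ Submonoid.closure S, s * a ∈ I}
  zero_mem' := ⟨1, one_mem _, by simp⟩
  add_mem' := by
    rintro a b ⟨s, hs, ha⟩ ⟨t, ht, hb⟩
    refine ⟨s * t, mul_mem hs ht, ?_⟩
    have : s * t * (a + b) = t * (s * a) + s * (t * b) := by ring
    rw [this]
    exact I.add_mem (I.mul_mem_left _ ha) (I.mul_mem_left _ hb)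
  smul_mem' := by
    rintro c a ⟨s, hs, ha⟩
    refine ⟨s, hs, ?_⟩
    have : s * (c • a) = c * (s * a) := by rw [smul_eq_mul]; ring
    rw [this]
    exact I.mul_mem_left _ ha

/-- `Θ L`: all derivatives of the elements of `L`. -/
def thetaSet {n m : ℕ} (L : Set (DVar n m)) : Set (DVar n m) := {v | ∃ u ∈ L, ∃ θ, v = act θ u}

/-- `G` is a differential prolongation of `L`: `L ⊆ G ⊆ Θ L`, and `Θ L \ G` is invariant under
differentiation. -/
def IsProlongation {n m : ℕ} (L G : Set (DVar n m)) : Prop :=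
  L ⊆ G ∧ G ⊆ thetaSet L ∧
    ∀ v ∈ thetaSet L \ G, ∀ i : Fin m, act (Pi.single i 1) v ∈ thetaSet L \ G

/-- The set `G ∪ N` with `N = Θ Y \ Θ G`; for a differential prolongation `G` of `L` it is
`G ∪ (Θ Y \ Θ L)`, as `Θ G = Θ L`. -/
def prolongationVars {n m : ℕ} (G : Set (DVar n m)) : Set (DVar n m) := G ∪ (thetaSet G)ᶜ

/-- The prolongation ring `k[G ∪ N]`, a polynomial subring of `k{y_1, …, y_n}`. -/
noncomputable abbrev prolongationRing {n m : ℕ} (k : Type*) [Field k] (G : Set (DVar n m)) :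
    Subalgebra k (DPoly n m k) :=
  MvPolynomial.supported k (prolongationVars G)

/-- The prolongation ideal `I ∩ k[G ∪ N]`, an ideal of the prolongation ring `k[G ∪ N]`. -/
noncomputable def prolongationIdeal {n m : ℕ} {k : Type*} [Field k] (G : Set (DVar n m))
    (I : Ideal (DPoly n m k)) : Ideal (prolongationRing k G) :=
  I.comap (prolongationRing k G).val

/-- `I = P_1 ∩ … ∩ P_s` is the essential prime decomposition of `I`: the `P_i` are prime
differential ideals none of which contains another one. -/
def IsEssentialPrimeDecomposition {n m : ℕ} {k : Type*} [Field k] (d : Fin m → Derivation ℤ k k)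
    {s : ℕ} (I : Ideal (DPoly n m k)) (P : Fin s → Ideal (DPoly n m k)) : Prop :=
  (∀ i, (P i).IsPrime ∧ IsDifferential d (P i)) ∧ I = ⨅ i, P i ∧ ∀ i j, P i ≤ P j → i = j

/-- `J = Q_1 ∩ … ∩ Q_s` is the minimal prime decomposition of `J`: the `Q_i` are prime, none of
them contains another one, and they are the minimal primes of `J`. -/
def IsMinimalPrimeDecomposition {R : Type*} [CommRing R] {s : ℕ} (J : Ideal R)
    (Q : Fin s → Ideal R) : Prop :=
  (∀ i, (Q i).IsPrime) ∧ J = ⨅ i, Q i ∧ (∀ i j, Q i ≤ Q j → i = j) ∧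
    Set.range Q = J.minimalPrimes

end DiffAlg

/-! Contraction to the prolongation ring preserves primes and intersections, so the point is that
the contracted primes stay incomparable. Suppose the contraction of `P i` lies in `P j`, and let `f
∈ P i`. Partial Ritt reduction gives `h * f ≡ g` modulo `[C]`, where `h` is a product of separants
and `g` contains no proper derivative of a leader of `C`. Such a `g` lies in the prolongation ring,
whatever the prolongation. As `[C] ⊆ I ⊆ P i ∩ P j`, it follows that `g ∈ P i`, hence `g ∈ P j`,
hence `h * f ∈ P j`. Since `I` is saturated and the decomposition irredundant, `h ∉ P j`, so `f ∈ P
j`. Thus `P i ⊆ P j` and `i = j`. The two pillars are `IsAutoreduced.exists_partial_reduction` and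
`notMem_of_iInf_eq_saturation`. -/

namespace DiffAlg

/-! ### Finite intersections of primes and saturation -/

section PrimeDecompositions

variable {R : Type*} [CommRing R]

theorem subset_saturation (I : Ideal R) (S : Set R) : I ≤ saturation I S :=
  fun a ha => ⟨1, one_mem _, by simpa using ha⟩

theorem mem_saturation_of_mul_mem {I : Ideal R} {S : Set R} {h a : R}
    (hh : h ∈ Submonoid.closure S) (ha : h * a ∈ saturation I S) : a ∈ saturation I S := by
  obtain ⟨t, ht, hta⟩ := ha
  exact ⟨t * h, mul_mem ht hh, by rwa [mul_assoc]⟩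

/-- An irredundant finite intersection of primes whose intersection is saturated with respect to
`S` consists of primes that avoid the multiplicative set generated by `S`. -/
theorem notMem_of_iInf_eq_saturation {ι : Type*} [Fintype ι] {I J : Ideal R} {S : Set R}
    {P : ι → Ideal R} (hI : I = saturation J S) (hprime : ∀ i, (P i).IsPrime)
    (hinf : I = ⨅ i, P i) (hinc : ∀ i j, P i ≤ P j → i = j) {h : R}
    (hh : h ∈ Submonoid.closure S) (i : ι) : h ∉ P i := by
  classical
  intro hmem
  -- If `h ∈ P i` and `g` lies in all the other primes, then `h * g ∈ I`, and saturation gives `g ∈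
  -- I ⊆ P i`: the prime `P i` would be redundant.
  have hle : ((Finset.univ.erase i).inf P) ≤ P i := by
    intro g hg
    have hgI : h * g ∈ I := by
      rw [hinf, Ideal.mem_iInf]
      intro j
      by_cases hj : j = i
      · subst hj
        exact (P j).mul_mem_right _ hmem
      · exact (P j).mul_mem_left _
          ((Finset.inf_le (f := P) (Finset.mem_erase.2 ⟨hj, Finset.mem_univ j⟩)) hg)
    rw [hI] at hgI
    have := mem_saturation_of_mul_mem hh hgI
    rw [← hI, hinf, Ideal.mem_iInf] at this
    exact this i
  obtain ⟨j, hj, hji⟩ := (hprime i).inf_le'.1 hle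
  exact (Finset.mem_erase.1 hj).1 (hinc j i hji)

/-- A prime that contains a finite intersection contains one of its members, so every prime over `J`
lies above some `Q i`; incomparability then makes each `Q i` minimal. -/
theorem isMinimalPrimeDecomposition_of_incomparable {s : ℕ} {J : Ideal R} {Q : Fin s → Ideal R}
    (hprime : ∀ i, (Q i).IsPrime) (hinf : J = ⨅ i, Q i) (hinc : ∀ i j, Q i ≤ Q j → i = j) :
    IsMinimalPrimeDecomposition J Q := by
  have key : ∀ p : Ideal R, p.IsPrime → J ≤ p → ∃ i, Q i ≤ p := by
    intro p hp hJ
    have : (Finset.univ.inf Q) ≤ p := by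
      rwa [Finset.inf_univ_eq_iInf, ← hinf]
    obtain ⟨i, -, hi⟩ := hp.inf_le'.1 this
    exact ⟨i, hi⟩
  have hJQ : ∀ i, J ≤ Q i := fun i => hinf ▸ iInf_le Q i
  refine ⟨hprime, hinf, hinc, Set.Subset.antisymm ?_ ?_⟩
  · rintro _ ⟨i, rfl⟩
    refine ⟨⟨hprime i, hJQ i⟩, ?_⟩
    rintro p ⟨hp, hJ⟩ hpi
    obtain ⟨j, hj⟩ := key p hp hJ
    obtain rfl := hinc j i (hj.trans hpi)
    exact hj
  · rintro p ⟨⟨hp, hJ⟩, hmin⟩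
    obtain ⟨i, hi⟩ := key p hp hJ
    exact ⟨i, le_antisymm hi (hmin ⟨hprime i, hJQ i⟩ hi)⟩

end PrimeDecompositions

/-! ### Rankings and their well-foundedness -/

section Rankings

variable {n m : ℕ}

/-- The strict order of a ranking. -/
def Ranking.lt (r : Ranking n m) (u v : DVar n m) : Prop := r.le u v ∧ u ≠ v

theorem Ranking.le_refl (r : Ranking n m) (u : DVar n m) : r.le u u :=
  (r.le_total u u).elim id id

theorem Ranking.lt_of_le_of_lt (r : Ranking n m) {u v w : DVar n m} (h : r.le u v)
    (h' : r.lt v w) : r.lt u w := by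
  refine ⟨r.le_trans _ _ _ h h'.1, ?_⟩
  rintro rfl
  exact h'.2 (r.le_antisymm _ _ h'.1 h)

theorem Ranking.lt_of_lt_of_le (r : Ranking n m) {u v w : DVar n m} (h : r.lt u v)
    (h' : r.le v w) : r.lt u w := by
  refine ⟨r.le_trans _ _ _ h.1 h', ?_⟩
  rintro rfl
  exact h.2 (r.le_antisymm _ _ h.1 h')

theorem act_act (θ φ : Fin m → ℕ) (u : DVar n m) : act θ (act φ u) = act (θ + φ) u := by
  simp [act, add_assoc]

theorem act_zero (u : DVar n m) : act 0 u = u := by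
  simp [act]

theorem act_injective (θ : Fin m → ℕ) : Function.Injective (act θ : DVar n m → DVar n m) := by
  rintro ⟨a, b⟩ ⟨a', b'⟩ h
  simpa [act] using h

theorem act_ne_self {θ : Fin m → ℕ} (hθ : θ ≠ 0) (u : DVar n m) : act θ u ≠ u := by
  intro h
  exact hθ (by simpa [act, Prod.ext_iff] using h)

theorem Ranking.lt_act (r : Ranking n m) {θ : Fin m → ℕ} (hθ : θ ≠ 0) (u : DVar n m) :
    r.lt u (act θ u) :=
  ⟨r.le_act θ u, (act_ne_self hθ u).symm⟩

theorem Ranking.act_lt_act (r : Ranking n m) (θ : Fin m → ℕ) {u v : DVar n m} (h : r.lt u v) :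
    r.lt (act θ u) (act θ v) :=
  ⟨r.act_le_act _ _ _ h.1, fun h' => h.2 (act_injective θ h')⟩

/-- Every ranking is a well-order. -/
theorem Ranking.wellFounded_lt (r : Ranking n m) : WellFounded r.lt := by
  rw [wellFounded_iff_isEmpty_descending_chain]
  refine ⟨fun ⟨f, hf⟩ => ?_⟩
  have hdesc : ∀ i j, i < j → r.lt (f j) (f i) := by
    intro i j hij
    induction j, hij using Nat.le_induction with
    | base => exact hf i
    | succ j _ ih => exact r.lt_of_lt_of_le (hf j) ih.1
  -- Infinitely many terms of the chain involve the same indeterminate. Among their exponent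
  -- vectors, Dickson's lemma finds an earlier one below a later one; the later term is then a
  -- derivative of the earlier one and cannot be strictly lower.
  obtain ⟨c, hc⟩ := Finite.exists_infinite_fiber fun i => (f i).1
  have hinf : Set.Infinite ((fun i => (f i).1) ⁻¹' {c}) := Set.infinite_coe_iff.1 hc
  have hwqo : WellQuasiOrdered ((· ≤ ·) : (Fin m → ℕ) → (Fin m → ℕ) → Prop) := wellQuasiOrdered_le
  obtain ⟨i, j, hij, hle⟩ := hwqo fun i => (f (Nat.nth (· ∈ (fun i => (f i).1) ⁻¹' {c}) i)).2
  have hmem := fun i => Nat.nth_mem_of_infinite (p := (· ∈ (fun i => (f i).1) ⁻¹' {c})) hinf i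
  have hlt := hdesc _ _ (Nat.nth_strictMono hinf hij)
  set a := f (Nat.nth (· ∈ (fun i => (f i).1) ⁻¹' {c}) i) with ha
  set b := f (Nat.nth (· ∈ (fun i => (f i).1) ⁻¹' {c}) j) with hb
  have hab : b = act (b.2 - a.2) a := by
    have h1 : a.1 = c := hmem i
    have h2 : b.1 = c := hmem j
    refine Prod.ext (h2.trans h1.symm) ?_
    exact (tsub_add_cancel_of_le hle).symm
  have : r.le a b := by
    rw [hab]
    exact r.le_act _ _
  exact hlt.2 (r.le_antisymm _ _ hlt.1 this)

end Rankings

/-! ### Leading terms of derivatives of a polynomial -/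

section Derivatives

open MvPolynomial

variable {n m : ℕ} {k : Type*} [Field k]

theorem polyDeriv_C (d : Fin m → Derivation ℤ k k) (i : Fin m) (a : k) :
    polyDeriv d i (C a : DPoly n m k) = C (d i a) := by
  have h : coeffDeriv (σ := DVar n m) (d i) (C a) = C (d i a) := coeffDerivAux_monomial (d i) 0 a
  simp [polyDeriv, h]

theorem polyDeriv_X (d : Fin m → Derivation ℤ k k) (i : Fin m) (u : DVar n m) :
    polyDeriv d i (X u : DPoly n m k) = X (act (Pi.single i 1) u) := by
  have h : coeffDeriv (σ := DVar n m) (d i) (X u) = 0 := by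
    refine (coeffDerivAux_monomial (d i) (Finsupp.single u 1) 1).trans ?_
    simp
  simp [polyDeriv, h, mkDerivation_X]

/-- A derivation maps a polynomial subring into a larger one if it does so on the constants and on
the variables. -/
theorem derivation_mem_supported {σ : Type*} {V W : Set σ} (hVW : V ⊆ W)
    (D : Derivation ℤ (MvPolynomial σ k) (MvPolynomial σ k))
    (hC : ∀ a, D (C a) ∈ supported k W) (hX : ∀ v ∈ V, D (X v) ∈ supported k W)
    {f : MvPolynomial σ k} (hf : f ∈ supported k V) : D f ∈ supported k W := by
  have hmono := supported_mono (R := k) hVW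
  rw [supported] at hf
  induction hf using Algebra.adjoin_induction with
  | mem x hx =>
    obtain ⟨v, hv, rfl⟩ := hx
    exact hX v hv
  | algebraMap a => exact hC a
  | add f g _ _ hf hg => rw [map_add]; exact add_mem hf hg
  | mul f g hfV hgV hf hg =>
    rw [Derivation.leibniz, smul_eq_mul, smul_eq_mul]
    exact add_mem (mul_mem (hmono hfV) hg) (mul_mem (hmono hgV) hf)

theorem polyDeriv_mem_supported_lt (d : Fin m → Derivation ℤ k k) (r : Ranking n m) (i : Fin m)
    {v : DVar n m} {f : DPoly n m k} (hf : f ∈ supported k {w | r.lt w v}) :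
    polyDeriv d i f ∈ supported k {w | r.lt w (act (Pi.single i 1) v)} := by
  refine derivation_mem_supported (fun w hw => r.lt_of_lt_of_le hw (r.le_act _ _)) _ ?_ ?_ hf
  · intro a
    rw [polyDeriv_C]
    exact (supported k _).algebraMap_mem _
  · intro w hw
    rw [polyDeriv_X]
    exact X_mem_supported.2 (r.act_lt_act _ hw)

/-- By the chain rule, `δ_i u` arises only from differentiating `u`, with the separant as
coefficient; all other variables that occur are lower. -/
theorem polyDeriv_sub_separant_mul_mem (d : Fin m → Derivation ℤ k k) (r : Ranking n m)
    (i : Fin m) {u : DVar n m} {f : DPoly n m k} (hf : f ∈ supported k {w | r.le w u}) :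
    polyDeriv d i f - pderiv u f * X (act (Pi.single i 1) u) ∈
      supported k {w | r.lt w (act (Pi.single i 1) u)} := by
  classical
  have hi : (Pi.single i 1 : Fin m → ℕ) ≠ 0 := by simp
  -- The difference is itself a derivation in `f`, and it kills `X u`, so it need only be checked on
  -- constants and variables.
  let D : Derivation ℤ (DPoly n m k) (DPoly n m k) :=
    polyDeriv d i -
      (X (act (Pi.single i 1) u) : DPoly n m k) • (pderiv (R := k) u).restrictScalars ℤ
  have hD : ∀ g, D g = polyDeriv d i g - pderiv u g * X (act (Pi.single i 1) u) := fun g => by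
    simp [D, mul_comm]
  rw [← hD]
  refine derivation_mem_supported (fun w hw => r.lt_of_le_of_lt hw (r.lt_act hi u)) _ ?_ ?_ hf
  · intro a
    rw [hD, polyDeriv_C, pderiv_C, zero_mul, sub_zero]
    exact (supported k _).algebraMap_mem _
  · intro w hw
    rw [hD, polyDeriv_X]
    by_cases h : w = u
    · subst h
      simp
    · rw [pderiv_X_of_ne h, zero_mul, sub_zero]
      exact X_mem_supported.2 (r.act_lt_act _ ⟨hw, h⟩)

theorem pderiv_mem_supported {σ : Type*} {V : Set σ} (u : σ) {f : MvPolynomial σ k}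
    (hf : f ∈ supported k V) : pderiv u f ∈ supported k V := by
  classical
  refine derivation_mem_supported subset_rfl ((pderiv (R := k) u).restrictScalars ℤ) ?_ ?_ hf
  · intro a
    simp
  · intro v _
    by_cases h : v = u
    · subst h
      simp
    · simp [pderiv_X_of_ne h]

/-- A proper derivative `θ f` is congruent, modulo polynomials in derivatives lower than its leader
`θ u`, to the product of the separant of `f` and `θ u`. -/
theorem exists_sub_separant_mul_mem (d : Fin m → Derivation ℤ k k) (r : Ranking n m)
    {J : Ideal (DPoly n m k)} (hJ : IsDifferential d J) {f : DPoly n m k} (hfJ : f ∈ J)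
    {u : DVar n m} (hf : f ∈ supported k {w | r.le w u}) (θ : Fin m → ℕ) (hθ : θ ≠ 0) :
    ∃ g ∈ J, g - pderiv u f * X (act θ u) ∈ supported k {w | r.lt w (act θ u)} := by
  -- Induction on the order of `θ`, splitting off one `δ_i` at a time.
  obtain ⟨N, hN⟩ : ∃ N, N = ∑ j, θ j := ⟨_, rfl⟩
  induction N generalizing θ with
  | zero =>
    exact absurd (funext fun j => (Finset.sum_eq_zero_iff.1 hN.symm) j (Finset.mem_univ j)) hθ
  | succ N ih =>
    obtain ⟨i, hi⟩ : ∃ i, θ i ≠ 0 := by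
      by_contra! h
      exact hθ (funext h)
    obtain ⟨φ, rfl⟩ : ∃ φ : Fin m → ℕ, θ = Pi.single i 1 + φ := by
      refine ⟨θ - Pi.single i 1, (add_tsub_cancel_of_le ?_).symm⟩
      intro j
      by_cases h : j = i
      · subst h
        simp only [Pi.single_eq_same]
        omega
      · simp [h]
    by_cases hφ : φ = 0
    · subst hφ
      rw [add_zero]
      exact ⟨_, hJ i f hfJ, polyDeriv_sub_separant_mul_mem d r i hf⟩
    · obtain ⟨g, hg, hmem⟩ := ih φ hφ (by
        simp only [Pi.add_apply, Finset.sum_add_distrib, Finset.sum_pi_single', Finset.mem_univ,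
          if_true] at hN
        omega)
      refine ⟨_, hJ i g hg, ?_⟩
      have hsep : pderiv u f ∈ supported k {w | r.lt w (act φ u)} :=
        supported_mono (fun w hw => r.lt_of_le_of_lt hw (r.lt_act hφ u))
          (pderiv_mem_supported u hf)
      have h1 := polyDeriv_mem_supported_lt d r i hmem
      have h2 := polyDeriv_mem_supported_lt d r i hsep
      rw [act_act] at h1 h2
      have h3 : (X (act φ u) : DPoly n m k) ∈
          supported k {w | r.lt w (act (Pi.single i 1 + φ) u)} := by
        refine X_mem_supported.2 ?_
        rw [← act_act]
        exact r.lt_act (by simp) _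
      -- By the product rule the coefficient of the top derivative is still the separant; the extra
      -- term, `φ u` times `δ_i` of the separant, involves only lower derivatives.
      have h4 : polyDeriv d i g - pderiv u f * X (act (Pi.single i 1 + φ) u) =
          polyDeriv d i (g - pderiv u f * X (act φ u)) +
            X (act φ u) * polyDeriv d i (pderiv u f) := by
        rw [map_sub, Derivation.leibniz, polyDeriv_X, act_act, smul_eq_mul, smul_eq_mul]
        ring
      rw [h4]
      exact add_mem h1 (mul_mem h3 h2)

theorem isDifferential_diffSpan (d : Fin m → Derivation ℤ k k) (F : Set (DPoly n m k)) :
    IsDifferential d (diffSpan d F) := by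
  intro i f hf
  simp only [diffSpan, Submodule.mem_sInf, Set.mem_ofPred_eq] at hf ⊢
  exact fun J hJ => hJ.1 i f (hf J hJ)

theorem subset_diffSpan (d : Fin m → Derivation ℤ k k) (F : Set (DPoly n m k)) :
    F ⊆ (diffSpan d F : Set (DPoly n m k)) := by
  intro f hf
  simp only [diffSpan, SetLike.mem_coe, Submodule.mem_sInf, Set.mem_ofPred_eq]
  exact fun J hJ => hJ.2 hf

end Derivatives

/-! ### Partial Ritt reduction -/

section Reduction

open MvPolynomial

variable {n m : ℕ} {k : Type*} [Field k]

/-- The polynomials that, after multiplication by an element of the multiplicative set `M`, are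
congruent modulo `J` to an element of the subalgebra `B`. -/
def reducibleTo {R A : Type*} [CommRing R] [CommRing A] [Algebra R A] (J : Ideal A)
    (M : Submonoid A) (B : Subalgebra R A) (hM : ∀ h ∈ M, h ∈ B) : Subalgebra R A where
  carrier := {f | ∃ h ∈ M, ∃ b ∈ B, h * f - b ∈ J}
  mul_mem' := by
    rintro f g ⟨h, hh, b, hb, hf⟩ ⟨h', hh', b', hb', hg⟩
    refine ⟨h * h', mul_mem hh hh', b * b', mul_mem hb hb', ?_⟩
    have : h * h' * (f * g) - b * b' = h' * g * (h * f - b) + b * (h' * g - b') := by ring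
    rw [this]
    exact add_mem (J.mul_mem_left _ hf) (J.mul_mem_left _ hg)
  add_mem' := by
    rintro f g ⟨h, hh, b, hb, hf⟩ ⟨h', hh', b', hb', hg⟩
    -- Over the common multiplier `h * h'` the remainders get multiplied by elements of `M`, hence
    -- the requirement that `M` lie in `B`.
    refine ⟨h * h', mul_mem hh hh', h' * b + h * b',
      add_mem (mul_mem (hM _ hh') hb) (mul_mem (hM _ hh) hb'), ?_⟩
    have : h * h' * (f + g) - (h' * b + h * b') = h' * (h * f - b) + h * (h' * g - b') := by ring
    rw [this]
    exact add_mem (J.mul_mem_left _ hf) (J.mul_mem_left _ hg)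
  algebraMap_mem' a := ⟨1, one_mem _, _, B.algebraMap_mem a, by simp⟩

/-- The derivatives that are not proper derivatives of elements of `L`. -/
def partiallyReducedVars (L : Set (DVar n m)) : Set (DVar n m) :=
  {v | ∀ u ∈ L, ∀ θ : Fin m → ℕ, θ ≠ 0 → v ≠ act θ u}

/-- A derivative outside `G ∪ N` lies in `Θ G ⊆ Θ L` but not in `G ⊇ L`, so it is a proper
derivative of an element of `L`. -/
theorem partiallyReducedVars_subset_prolongationVars {L G : Set (DVar n m)}
    (h : IsProlongation L G) : partiallyReducedVars L ⊆ prolongationVars G := by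
  intro v hv
  by_contra hcon
  simp only [prolongationVars, Set.mem_union, Set.mem_compl_iff, not_or, not_not] at hcon
  obtain ⟨hvG, w, hw, θ, rfl⟩ := hcon
  obtain ⟨u, hu, φ, rfl⟩ := h.2.1 hw
  rw [act_act] at hv hvG
  by_cases h0 : θ + φ = 0
  · rw [h0, act_zero] at hvG
    exact hvG (h.1 hu)
  · exact hv u hu _ h0 rfl

/-- The separants of the elements of `A`. -/
def separants (r : Ranking n m) (A : Set (DPoly n m k)) : Set (DPoly n m k) :=
  {h | ∃ f ∈ A, ∃ u, IsLeader r f u ∧ h = pderiv u f}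

theorem separants_subset_initSep (r : Ranking n m) (A : Set (DPoly n m k)) :
    separants r A ⊆ initSep r A := by
  rintro _ ⟨f, hf, u, hu, rfl⟩
  exact ⟨f, hf, u, hu, Or.inr rfl⟩

/-- Proper derivatives of the leader of `f` itself rank too high to occur in `f`; those of the other
leaders are excluded by autoreducedness. -/
theorem IsAutoreduced.mem_supported {r : Ranking n m} {A : Finset (DPoly n m k)}
    (hA : IsAutoreduced r A) {f : DPoly n m k} (hf : f ∈ A) :
    f ∈ supported k (partiallyReducedVars (leaders r (A : Set (DPoly n m k)))) := by
  classical
  rw [MvPolynomial.mem_supported]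
  rintro v hv u ⟨g, hg, hu⟩ θ hθ rfl
  by_cases hfg : f = g
  · subst hfg
    exact (act_ne_self hθ u) (r.le_antisymm _ _ (hu.2 _ hv) (r.le_act θ u))
  · exact (hA.2 f hf g hg hfg u hu).1 θ hθ hv

theorem IsAutoreduced.closure_separants_mem_supported {r : Ranking n m}
    {A : Finset (DPoly n m k)} (hA : IsAutoreduced r A) :
    ∀ h ∈ Submonoid.closure (separants r (A : Set (DPoly n m k))),
      h ∈ supported k (partiallyReducedVars (leaders r (A : Set (DPoly n m k)))) := by
  intro h hh
  have hle : Submonoid.closure (separants r (A : Set (DPoly n m k))) ≤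
      (supported k
        (partiallyReducedVars (leaders r (A : Set (DPoly n m k))))).toSubsemiring.toSubmonoid := by
    rw [Submonoid.closure_le]
    rintro _ ⟨f, hf, u, -, rfl⟩
    exact pderiv_mem_supported u (hA.mem_supported hf)
  exact hle hh

/-- Partial Ritt reduction with respect to an autoreduced set. -/
theorem IsAutoreduced.exists_partial_reduction (d : Fin m → Derivation ℤ k k) {r : Ranking n m}
    {A : Finset (DPoly n m k)} (hA : IsAutoreduced r A) (f : DPoly n m k) :
    ∃ h ∈ Submonoid.closure (separants r (A : Set (DPoly n m k))),
      ∃ g ∈ supported k (partiallyReducedVars (leaders r (A : Set (DPoly n m k)))),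
        h * f - g ∈ diffSpan d (A : Set (DPoly n m k)) := by
  let T := reducibleTo (diffSpan d (A : Set (DPoly n m k)))
    (Submonoid.closure (separants r (A : Set (DPoly n m k))))
    (supported k (partiallyReducedVars (leaders r (A : Set (DPoly n m k)))))
    hA.closure_separants_mem_supported
  -- As `T` is a subalgebra, it is enough to reduce single variables, by induction along the
  -- ranking.
  have hX : ∀ v : DVar n m, (X v : DPoly n m k) ∈ T := by
    intro v
    induction v using r.wellFounded_lt.induction with
    | _ v ih =>
    by_cases hv : v ∈ partiallyReducedVars (leaders r (A : Set (DPoly n m k)))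
    · exact ⟨1, one_mem _, X v, X_mem_supported.2 hv, by simp⟩
    · simp only [partiallyReducedVars, Set.mem_ofPred_eq, not_forall, not_not] at hv
      obtain ⟨u, ⟨p, hp, hu⟩, θ, hθ, rfl⟩ := hv
      have hpu : p ∈ supported k {w | r.le w u} := by
        rw [MvPolynomial.mem_supported]
        exact fun w hw => hu.2 w hw
      obtain ⟨q, hq, hmem⟩ := exists_sub_separant_mul_mem d r (isDifferential_diffSpan d _)
        (subset_diffSpan d _ hp) hpu θ hθ
      have hlow : supported k {w | r.lt w (act θ u)} ≤ T := by
        rw [supported, Algebra.adjoin_le_iff]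
        rintro _ ⟨w, hw, rfl⟩
        exact ih w hw
      -- Modulo `[A]`, the separant times `θ u` is minus the tail of `q`. The tail involves only
      -- lower derivatives, so some `h` reduces it to `b`; hence the remainder `-b`.
      obtain ⟨h, hh, b, hb, hc⟩ := hlow hmem
      refine ⟨h * pderiv u p, mul_mem hh (Submonoid.subset_closure ⟨p, hp, u, hu, rfl⟩), -b,
        neg_mem hb, ?_⟩
      have : h * pderiv u p * X (act θ u) - -b =
          h * q - (h * (q - pderiv u p * X (act θ u)) - b) := by ring
      rw [this]
      exact sub_mem (Ideal.mul_mem_left _ _ hq) hc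
  have hT : f ∈ T := by
    induction f using MvPolynomial.induction_on with
    | C a => exact T.algebraMap_mem a
    | add p q hp hq => exact add_mem hp hq
    | mul_X p v hp => exact mul_mem hp (hX v)
  exact hT

end Reduction

end DiffAlg

/-! ### The minimal prime decomposition of the prolongation ideal -/

theorem lemmal {n m : ℕ} {k : Type*} [Field k] [CharZero k]
    (d : Fin m → Derivation ℤ k k) (hd : ∀ i j a, d i (d j a) = d j (d i a))
    (r : DiffAlg.Ranking n m)
    (I : Ideal (DiffAlg.DPoly n m k)) (C : Finset (DiffAlg.DPoly n m k))
    (hC : DiffAlg.IsCharacteristicSet r (I : Set (DiffAlg.DPoly n m k)) C)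
    (hI : I = DiffAlg.saturation (DiffAlg.diffSpan d (C : Set (DiffAlg.DPoly n m k)))
      (DiffAlg.initSep r (C : Set (DiffAlg.DPoly n m k))))
    (Lbar : Set (DiffAlg.DVar n m))
    (hL : DiffAlg.IsProlongation
      (DiffAlg.leaders r (C : Set (DiffAlg.DPoly n m k))) Lbar)
    (s : ℕ) (P : Fin s → Ideal (DiffAlg.DPoly n m k))
    (hP : DiffAlg.IsEssentialPrimeDecomposition d I P) :
    DiffAlg.IsMinimalPrimeDecomposition (DiffAlg.prolongationIdeal Lbar I)
      (fun i => DiffAlg.prolongationIdeal Lbar (P i)) := by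
  obtain ⟨hprime, hinf, hinc⟩ := hP
  refine DiffAlg.isMinimalPrimeDecomposition_of_incomparable
    (fun i => (hprime i).1.comap _) ?_ fun i j hij => hinc i j fun f hf => ?_
  · simp only [DiffAlg.prolongationIdeal]
    rw [hinf, Ideal.comap_iInf]
  -- The remainder `g` carries membership from `P i` to `P j`, because it lies in the prolongation
  -- ring where `hij` applies.
  · obtain ⟨h, hh, g, hg, hfg⟩ := hC.1.exists_partial_reduction d f
    have hIP : ∀ l, h * f - g ∈ P l := fun l => by
      have : h * f - g ∈ I := hI ▸ DiffAlg.subset_saturation _ _ hfg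
      rw [hinf, Ideal.mem_iInf] at this
      exact this l
    have hgi : g ∈ P i := by
      have := (P i).sub_mem ((P i).mul_mem_left h hf) (hIP i)
      rwa [sub_sub_cancel] at this
    have hgV := MvPolynomial.supported_mono (R := k)
      (DiffAlg.partiallyReducedVars_subset_prolongationVars hL) hg
    have hgj : g ∈ P j := hij (x := ⟨g, hgV⟩) hgi
    have hhf : h * f ∈ P j := by
      have := (P j).add_mem (hIP j) hgj
      rwa [sub_add_cancel] at this
    exact ((hprime j).1.mem_or_mem hhf).resolve_left
      (DiffAlg.notMem_of_iInf_eq_saturation hI (fun l => (hprime l).1) hinf hinc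
        (Submonoid.closure_mono (DiffAlg.separants_subset_initSep r _) hh) j)
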